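/- Let $\mathbb N=\{1,2,3,\dots\}$, $\mathbb T=\mathbb R/\mathbb Z$ and $e(\theta)=\exp(2\pi i\theta)$. For $S\subset\mathbb N$ write $S(N)=S\cap\{1,\dots,N\}$, and for a finite non-empty set $F\subset\mathbb N$ write $\mathbb A_{s\in F}f(s)=\frac1{\#F}\sum_{s\in F}f(s)$. An infinite set $S\subset\mathbb N$ is called *good* if $\lim_{N\to\infty}\mathbb A_{s\in S(N)}\,e(s\beta)$ exists for every $\beta\in\mathbb R$. **Theorem (Only continuous measures can be represented at irrational points).** Let $\alpha$ be an irrational number. 1. If $S\subset\mathbb N$ is a good set, then the measures $\mathbb A_{s\in S(N)}\delta_{s\alpha}$ on $\mathbb T$ converge weakly, as $N\to\infty$, to a (unique) Borel probability measure $\mu_{S,\alpha}$; that is, $\int_{\mathbb T}\phi\,d\mu_{S,\alpha}=\lim_{N\to\infty}\mathbb A_{s\in S(N)}\,\phi(s\alpha)$ for every continuous $\phi:\mathbb T\to\mathbb C$. The measure $\mu_{S,\alpha}$ is continuous: $\mu_{S,\alpha}(\{x\})=0$ for every $x\in\mathbb T$. 2. In other words, only continuous measures can be represented at an irrational number: if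 $\nu$ is a finite non-zero Borel measure on $\mathbb T$ and there is a good set $S$ with $\mu_{S,\alpha}=\frac1{\nu(\mathbb T)}\nu$, then $\nu(\{x\})=0$ for every $x\in\mathbb T$. -/

import Mathlib

open Filter Topology MeasureTheory

noncomputable section

open scoped Classical in
/-- The initial segment `S(N) = S ∩ {1, …, N}`. -/
def initialSegment (S : Set ℕ) (N : ℕ) : Finset ℕ :=
  (Finset.Icc 1 N).filter (fun s => s ∈ S)

/-- The arithmetic average of `f` over the finite set `F`. -/
def arithAverage (F : Finset ℕ) (f : ℕ → ℂ) : ℂ :=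
  (F.card : ℂ)⁻¹ * ∑ s ∈ F, f s

/-- A good set: an infinite set of positive integers such that for every `β` the averages of
`e(sβ) = exp(2πi sβ)` over `s ∈ S(N)` converge as `N → ∞`. -/
structure IsGoodSet (S : Set ℕ) : Prop where
  pos : ∀ s ∈ S, 0 < s
  infinite : S.Infinite
  converges : ∀ β : ℝ, ∃ l : ℂ,
    Tendsto (fun N : ℕ => arithAverage (initialSegment S N)
      (fun s => Complex.exp (2 * Real.pi * Complex.I * ((s : ℂ) * (β : ℂ))))) atTop (𝓝 l)

/-- The `N`th transform measure: the average of the Dirac masses at `sα` in the torus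
`ℝ / ℤ`, over `s ∈ S(N)`. -/
def transformMeasure (S : Set ℕ) (α : ℝ) (N : ℕ) : Measure UnitAddCircle :=
  ((initialSegment S N).card : ENNReal)⁻¹ •
    ∑ s ∈ initialSegment S N, Measure.dirac (((s : ℝ) * α : ℝ) : UnitAddCircle)

/-- Integration against the transform measure is the arithmetic average over `S(N)`. -/
theorem integral_transformMeasure (S : Set ℕ) (α : ℝ) (N : ℕ) (φ : C(UnitAddCircle, ℂ)) :
    ∫ x, φ x ∂(transformMeasure S α N) =
      arithAverage (initialSegment S N) (fun s => φ (((s : ℝ) * α : ℝ) : UnitAddCircle)) := by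
  unfold transformMeasure arithAverage
  rw [integral_smul_measure, integral_finsetSum_measure]
  · simp [integral_dirac, Complex.real_smul]
  · intro s _
    exact integrable_dirac (by simp)

/-- `μ` is the limit measure of `S` at `α`: a Borel probability measure on the torus to which
the transform measures converge weakly. -/
structure IsLimitMeasure (S : Set ℕ) (α : ℝ) (μ : Measure UnitAddCircle) : Prop where
  isProbabilityMeasure : IsProbabilityMeasure μ
  tendsto_integral : ∀ φ : C(UnitAddCircle, ℂ),
    Tendsto (fun N : ℕ => ∫ x, φ x ∂(transformMeasure S α N)) atTop (𝓝 (∫ x, φ x ∂μ))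

/-- The good set `S` represents `ν` at `α`: its limit measure at `α` is `ν` normalized to have
total mass one. (This forces the total mass of `ν` to be positive and finite.) -/
def Represents (S : Set ℕ) (ν : Measure UnitAddCircle) (α : ℝ) : Prop :=
  IsGoodSet S ∧ IsLimitMeasure S α ((ν Set.univ)⁻¹ • ν)

/-- `ν` is representable at `α` if some good set represents it there. -/
def IsRepresentable (ν : Measure UnitAddCircle) (α : ℝ) : Prop :=
  ∃ S : Set ℕ, Represents S ν α

end

/-! Existence of the limit is compactness: goodness at every `jα` makes all Fourier coefficients
converge along the full sequence, so an ultrafilter limit of the averages is the true limit.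

For continuity, suppose `μ {x} = m > 0`. The coefficients of `μ` are the values at `kα` of the
pointwise limit of the continuous functions `expAverage S N`. A twisted Wiener lemma
(`tendsto_weightedAverage_integral_fourier`) shows that averaging `e(-kx) μ̂(k) φ(kα)` over `k`
gives `∫ φ A`, where `A` is `atomSeries`, a continuous function with real part at least `m` at `0`.
By Baire, the averages are nearly constant in `N`, from some `n` on, over an open set inside `{Re A
> m/2}`. For a bump `φ` supported there, `μ̂(k)` may be replaced by a fixed average at `kα`, and
equidistribution of `kα` turns the sum into an integral. By orthogonality the averages tend to `0`
in L², so `∫ φ A` is too small. -/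

/-! ### Functionals on continuous functions and density of trigonometric polynomials. -/

/-- Integration against `A dμ`, as a linear functional on continuous functions. -/
noncomputable def integralAgainst (μ : Measure UnitAddCircle) [IsFiniteMeasure μ]
    (A : C(UnitAddCircle, ℂ)) : C(UnitAddCircle, ℂ) →ₗ[ℂ] ℂ where
  toFun φ := ∫ x, φ x * A x ∂μ
  map_add' φ ψ := by
    rw [← integral_add]
    · simp [add_mul]
    · exact (φ * A).continuous.integrable_of_hasCompactSupport (HasCompactSupport.of_compactSpace _)
    · exact (ψ * A).continuous.integrable_of_hasCompactSupport (HasCompactSupport.of_compactSpace _)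
  map_smul' c φ := by
    simp [mul_assoc, integral_const_mul]

theorem integralAgainst_apply (μ : Measure UnitAddCircle) [IsFiniteMeasure μ]
    (A φ : C(UnitAddCircle, ℂ)) : integralAgainst μ A φ = ∫ x, φ x * A x ∂μ := rfl

theorem norm_integralAgainst_le (μ : Measure UnitAddCircle) [IsProbabilityMeasure μ]
    (A φ : C(UnitAddCircle, ℂ)) : ‖integralAgainst μ A φ‖ ≤ ‖A‖ * ‖φ‖ := by
  have := norm_integral_le_of_norm_le_const (μ := μ) (f := fun x => φ x * A x) (C := ‖A‖ * ‖φ‖)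
    (Eventually.of_forall fun x => by
      rw [norm_mul, mul_comm]
      exact mul_le_mul (A.norm_coe_le_norm x) (φ.norm_coe_le_norm x) (norm_nonneg _)
        (norm_nonneg _))
  simpa [integralAgainst_apply] using this

/-- The weighted averages `K⁻¹ ∑_{k < K} g k φ(p k)`. -/
noncomputable def weightedAverage (g : ℕ → ℂ) (p : ℕ → UnitAddCircle) (K : ℕ) :
    C(UnitAddCircle, ℂ) →ₗ[ℂ] ℂ where
  toFun φ := (K : ℂ)⁻¹ * ∑ k ∈ Finset.range K, g k * φ (p k)
  map_add' φ ψ := by simp [mul_add, Finset.sum_add_distrib]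
  map_smul' c φ := by
    simp only [ContinuousMap.smul_apply, smul_eq_mul, RingHom.id_apply, Finset.mul_sum]
    exact Finset.sum_congr rfl fun k _ => by ring

theorem weightedAverage_apply (g : ℕ → ℂ) (p : ℕ → UnitAddCircle) (K : ℕ)
    (φ : C(UnitAddCircle, ℂ)) :
    weightedAverage g p K φ = (K : ℂ)⁻¹ * ∑ k ∈ Finset.range K, g k * φ (p k) := rfl

theorem norm_weightedAverage_le_of_forall {g : ℕ → ℂ} {p : ℕ → UnitAddCircle} {C : ℝ}
    (φ : C(UnitAddCircle, ℂ)) (hC : 0 ≤ C) (h : ∀ k, ‖g k * φ (p k)‖ ≤ C) (K : ℕ) :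
    ‖weightedAverage g p K φ‖ ≤ C := by
  rw [weightedAverage_apply, norm_mul, norm_inv, Complex.norm_natCast]
  rcases Nat.eq_zero_or_pos K with rfl | hK
  · simpa using hC
  · rw [inv_mul_le_iff₀ (by exact_mod_cast hK)]
    exact (norm_sum_le_of_le _ fun k _ => h k).trans (by simp)

theorem norm_weightedAverage_le {g : ℕ → ℂ} (hg : ∀ k, ‖g k‖ ≤ 1) (p : ℕ → UnitAddCircle)
    (K : ℕ) (φ : C(UnitAddCircle, ℂ)) : ‖weightedAverage g p K φ‖ ≤ 1 * ‖φ‖ := by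
  rw [one_mul]
  refine norm_weightedAverage_le_of_forall φ (norm_nonneg _) (fun k => ?_) K
  rw [norm_mul]
  exact (mul_le_of_le_one_left (norm_nonneg _) (hg k)).trans (φ.norm_coe_le_norm _)

/-- Uniformly bounded functionals that converge on the monomials converge everywhere. -/
theorem tendsto_of_tendsto_fourier {ι : Type*} {l : Filter ι}
    {T : ι → C(UnitAddCircle, ℂ) →ₗ[ℂ] ℂ}
    {L : C(UnitAddCircle, ℂ) →ₗ[ℂ] ℂ} {B C : ℝ} (hT : ∀ n φ, ‖T n φ‖ ≤ B * ‖φ‖)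
    (hL : ∀ φ, ‖L φ‖ ≤ C * ‖φ‖)
    (h : ∀ j, Tendsto (fun n => T n (fourier j)) l (𝓝 (L (fourier j))))
    (φ : C(UnitAddCircle, ℂ)) : Tendsto (fun n => T n φ) l (𝓝 (L φ)) := by
  have hspan : ∀ ψ ∈ Submodule.span ℂ (Set.range (@fourier (1 : ℝ))),
      Tendsto (fun n => T n ψ) l (𝓝 (L ψ)) := by
    intro ψ hψ
    induction hψ using Submodule.span_induction with
    | mem x hx => obtain ⟨j, rfl⟩ := hx; exact h j
    | zero => simp [tendsto_const_nhds]
    | add x y _ _ hx hy => simpa using hx.add hy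
    | smul c x _ hx => simpa using hx.const_mul c
  have hφ : φ ∈ (Submodule.span ℂ (Set.range (@fourier (1 : ℝ)))).topologicalClosure := by
    rw [span_fourier_closure_eq_top]; trivial
  rw [← SetLike.mem_coe, Submodule.topologicalClosure_coe, Metric.mem_closure_iff] at hφ
  rw [Metric.tendsto_nhds]
  intro ε hε
  -- The `+ 1` keeps the denominator positive when both bounds vanish.
  obtain ⟨ψ, hψ, hd⟩ := hφ (ε / (2 * (|B| + |C| + 1))) (by positivity)
  filter_upwards [Metric.tendsto_nhds.1 (hspan ψ hψ) (ε / 2) (by positivity)] with n hn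
  rw [dist_eq_norm] at *
  have h1 := hT n (φ - ψ)
  have h2 := hL (φ - ψ)
  have h3 : (B + C) * ‖φ - ψ‖ ≤ ε / 2 := by
    rw [lt_div_iff₀ (by positivity)] at hd
    nlinarith [le_abs_self B, le_abs_self C, norm_nonneg (φ - ψ)]
  have h4 : T n φ - L φ = T n (φ - ψ) - L (φ - ψ) + (T n ψ - L ψ) := by
    simp only [map_sub]; ring
  rw [h4]
  have := norm_add_le (T n (φ - ψ) - L (φ - ψ)) (T n ψ - L ψ)
  have := norm_sub_le (T n (φ - ψ)) (L (φ - ψ))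
  linarith

/-! ### Characters of the circle. -/

theorem fourier_natCast (k : ℕ) (y : UnitAddCircle) :
    fourier (k : ℤ) y = (fourier 1 y) ^ k := by
  simp only [fourier_apply, one_zsmul, natCast_zsmul, AddCircle.toCircle_nsmul, Circle.coe_pow]

theorem fourier_one_eq_one_iff (y : UnitAddCircle) : fourier 1 y = (1 : ℂ) ↔ y = 0 := by
  rw [fourier_one]
  constructor
  · intro h
    refine AddCircle.injective_toCircle one_ne_zero ?_
    rw [AddCircle.toCircle_zero]
    exact Circle.ext (by simpa using h)
  · rintro rfl; simp

theorem norm_fourier_apply (k : ℤ) (y : UnitAddCircle) : ‖fourier k y‖ = 1 := by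
  rw [fourier_apply, Circle.norm_coe]

open scoped Classical in
/-- The Cesàro averages of the powers of `fourier 1 y` converge to the indicator of `y = 0`. -/
theorem tendsto_average_fourier (y : UnitAddCircle) :
    Tendsto (fun K : ℕ => (K : ℂ)⁻¹ * ∑ k ∈ Finset.range K, fourier (k : ℤ) y) atTop
      (𝓝 (if y = 0 then 1 else 0)) := by
  split_ifs with hy
  · refine tendsto_const_nhds.congr' ?_
    filter_upwards [eventually_gt_atTop 0] with K hK
    have : (K : ℂ) ≠ 0 := by exact_mod_cast hK.ne'
    simp [hy, this]
  · have hz : fourier 1 y ≠ (1 : ℂ) := fun h => hy ((fourier_one_eq_one_iff y).1 h)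
    rw [tendsto_zero_iff_norm_tendsto_zero]
    refine squeeze_zero (fun _ => norm_nonneg _) (g := fun K : ℕ => (K : ℝ)⁻¹ *
      (2 / ‖fourier 1 y - (1 : ℂ)‖)) (fun K => ?_) ?_
    · simp only [fourier_natCast]
      rw [geom_sum_eq hz, norm_mul, norm_inv, Complex.norm_natCast, norm_div]
      gcongr
      refine (norm_sub_le _ _).trans ?_
      rw [norm_pow, norm_fourier_apply]
      norm_num
    · simpa using (tendsto_inv_atTop_nhds_zero_nat (𝕜 := ℝ)).mul_const _

theorem fourier_add_apply (k : ℤ) (x y : UnitAddCircle) :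
    fourier k (x + y) = fourier k x * fourier k y := by
  simp [fourier_apply, smul_add, AddCircle.toCircle_add]

theorem fourier_neg_apply (k : ℤ) (x : UnitAddCircle) : fourier k (-x) = fourier (-k) x := by
  simp [fourier_apply]

theorem fourier_zsmul (j k : ℤ) (x : UnitAddCircle) : fourier j (k • x) = fourier k (j • x) := by
  simp only [fourier_apply, smul_smul, mul_comm]

open AddCircle in
theorem integral_fourier (n : ℤ) :
    ∫ x : UnitAddCircle, fourier n x ∂haarAddCircle = if n = 0 then 1 else 0 := by
  split_ifs with h
  · simp [h]
  · exact integral_eq_zero_of_add_right_eq_neg (fourier_add_half_inv_index h one_pos)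

/-- Integrals of continuous functions determine a finite measure. -/
theorem measure_eq_of_integral_continuousMap_eq {μ ν : Measure UnitAddCircle} [IsFiniteMeasure μ]
    [IsFiniteMeasure ν] (h : ∀ φ : C(UnitAddCircle, ℂ), ∫ x, φ x ∂μ = ∫ x, φ x ∂ν) : μ = ν := by
  refine ext_of_forall_integral_eq_of_IsFiniteMeasure fun f => ?_
  have := h ⟨fun x => (f x : ℂ), by fun_prop⟩
  simp only [ContinuousMap.coe_mk] at this
  rw [integral_complex_ofReal, integral_complex_ofReal] at this
  exact_mod_cast this

/-! ### Exponential averages over `S`. -/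

/-- The average of the characters `fourier s` over `s ∈ S(N)`. -/
noncomputable def expAverage (S : Set ℕ) (N : ℕ) : C(UnitAddCircle, ℂ) :=
  ((initialSegment S N).card : ℂ)⁻¹ • ∑ s ∈ initialSegment S N, fourier (s : ℤ)

theorem expAverage_apply (S : Set ℕ) (N : ℕ) (β : UnitAddCircle) :
    expAverage S N β = arithAverage (initialSegment S N) (fun s => fourier (s : ℤ) β) := by
  simp [expAverage, arithAverage]

theorem IsGoodSet.exists_tendsto_expAverage {S : Set ℕ} (hS : IsGoodSet S) (β : UnitAddCircle) :
    ∃ l, Tendsto (fun N => expAverage S N β) atTop (𝓝 l) := by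
  obtain ⟨b, rfl⟩ := QuotientAddGroup.mk_surjective β
  obtain ⟨l, hl⟩ := hS.converges b
  refine ⟨l, hl.congr fun N => ?_⟩
  rw [expAverage_apply]
  congr 1
  funext s
  rw [fourier_coe_apply]
  congr 1
  push_cast
  ring

theorem integral_fourier_transformMeasure (S : Set ℕ) (α : ℝ) (N : ℕ) (k : ℤ) :
    ∫ x, fourier k x ∂(transformMeasure S α N) = expAverage S N (k • (α : UnitAddCircle)) := by
  rw [integral_transformMeasure, expAverage_apply]
  congr 1
  funext s
  have : (((s : ℝ) * α : ℝ) : UnitAddCircle) = (s : ℤ) • (α : UnitAddCircle) := by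
    rw [← AddCircle.coe_zsmul]; simp
  rw [this, fourier_zsmul]

theorem tendsto_card_initialSegment {S : Set ℕ} (hS : IsGoodSet S) :
    Tendsto (fun N => (initialSegment S N).card) atTop atTop := by
  classical
  rw [tendsto_atTop]
  intro n
  obtain ⟨t, htS, htn⟩ := hS.infinite.exists_subset_card_eq n
  filter_upwards [eventually_ge_atTop (t.sup id)] with N hN
  rw [← htn]
  refine Finset.card_le_card fun s hs => ?_
  simp only [initialSegment, Finset.mem_filter, Finset.mem_Icc]
  exact ⟨⟨hS.pos s (htS hs), (Finset.le_sup (f := id) hs).trans hN⟩, htS hs⟩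

-- Parseval: only the diagonal terms `s = t` survive. Hence the averages of a good set tend to `0`
-- in L².
open AddCircle in
theorem integral_norm_sq_expAverage (S : Set ℕ) (N : ℕ) :
    ∫ x, ‖expAverage S N x‖ ^ 2 ∂haarAddCircle = ((initialSegment S N).card : ℝ)⁻¹ := by
  have key : ∀ x, ((‖expAverage S N x‖ ^ 2 : ℝ) : ℂ) =
      ((initialSegment S N).card : ℂ)⁻¹ * ((initialSegment S N).card : ℂ)⁻¹ *
        ∑ s ∈ initialSegment S N, ∑ t ∈ initialSegment S N, fourier ((s : ℤ) - t) x := by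
    intro x
    rw [Complex.ofReal_pow, ← Complex.mul_conj', expAverage_apply, arithAverage]
    simp only [map_mul, map_inv₀, map_sum, map_natCast, ← fourier_neg, sub_eq_add_neg, fourier_add]
    rw [← Finset.sum_mul_sum]
    ring
  have h : ∫ x, ((‖expAverage S N x‖ ^ 2 : ℝ) : ℂ) ∂haarAddCircle =
      (((initialSegment S N).card : ℝ)⁻¹ : ℝ) := by
    simp only [key]
    have hint : ∀ n : ℤ, Integrable (fun x : UnitAddCircle => fourier n x) haarAddCircle :=
      fun n => (fourier n).continuous.integrable_of_hasCompactSupport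
        (HasCompactSupport.of_compactSpace _)
    rw [integral_const_mul, integral_finsetSum _ fun s _ => integrable_finsetSum _ fun t _ =>
      hint _]
    simp only [integral_finsetSum _ fun t _ => hint _, integral_fourier, sub_eq_zero, Nat.cast_inj]
    simp
    rcases eq_or_ne ((initialSegment S N).card : ℂ) 0 with h0 | h0
    · simp [h0]
    · field_simp
  rw [integral_complex_ofReal] at h
  exact_mod_cast h

theorem isProbabilityMeasure_transformMeasure {S : Set ℕ} {α : ℝ} {N : ℕ}
    (h : (initialSegment S N).card ≠ 0) : IsProbabilityMeasure (transformMeasure S α N) := by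
  constructor
  simp only [transformMeasure, Measure.smul_apply, Measure.finsetSum_apply, measure_univ,
    Finset.sum_const, smul_eq_mul, nsmul_eq_mul, mul_one]
  exact ENNReal.inv_mul_cancel (by exact_mod_cast h) (ENNReal.natCast_ne_top _)

/-! ### Existence and uniqueness of the limit measure. -/

/-- The transform measures of a good set converge weakly. -/
theorem IsGoodSet.exists_isLimitMeasure {S : Set ℕ} (hS : IsGoodSet S) (α : ℝ) :
    ∃ μ, IsLimitMeasure S α μ := by
  classical
  let P : ℕ → ProbabilityMeasure UnitAddCircle := fun N =>
    -- The Dirac mass is a filler for empty `S(N)`, which happens for only finitely many `N`.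
    if h : (initialSegment S N).card = 0 then ⟨Measure.dirac 0, inferInstance⟩
    else ⟨transformMeasure S α N, isProbabilityMeasure_transformMeasure h⟩
  have hP : ∀ᶠ N in atTop, (P N : Measure UnitAddCircle) = transformMeasure S α N := by
    filter_upwards [(tendsto_card_initialSegment hS).eventually_gt_atTop 0] with N hN
    simp [P, hN.ne']
  obtain ⟨μ, -, hμ⟩ := isCompact_univ.ultrafilter_le_nhds
    (Ultrafilter.map P (hyperfilter ℕ)) (by simp)
  have hμ' : Tendsto P (hyperfilter ℕ : Filter ℕ) (𝓝 μ) := hμ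
  rw [ProbabilityMeasure.tendsto_iff_forall_integral_rclike_tendsto ℂ] at hμ'
  refine ⟨μ, inferInstance, fun φ => ?_⟩
  have := tendsto_of_tendsto_fourier (l := atTop) (T := fun N => integralAgainst (P N) 1)
    (L := integralAgainst μ 1) (fun N => norm_integralAgainst_le _ _)
    (norm_integralAgainst_le _ _) (fun j => ?_) φ
  · simp only [integralAgainst_apply, ContinuousMap.one_apply, mul_one] at this
    refine this.congr' ?_
    filter_upwards [hP] with N hN
    rw [hN]
  · simp only [integralAgainst_apply, ContinuousMap.one_apply, mul_one]
    -- Goodness at `jα` gives a limit along all `N`; the ultrafilter limit can only agree with it.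
    obtain ⟨l, hl⟩ := hS.exists_tendsto_expAverage (j • (α : UnitAddCircle))
    have h1 : Tendsto (fun N => ∫ x, fourier j x ∂(P N : Measure UnitAddCircle)) atTop (𝓝 l) := by
      refine hl.congr' ?_
      filter_upwards [hP] with N hN
      rw [hN, integral_fourier_transformMeasure]
    have h2 := hμ' (BoundedContinuousFunction.mkOfCompact (fourier j))
    simp only [BoundedContinuousFunction.mkOfCompact_apply] at h2
    rwa [← tendsto_nhds_unique (h1.mono_left Nat.hyperfilter_le_atTop) h2]

theorem IsLimitMeasure.unique {S : Set ℕ} {α : ℝ} {μ ν : Measure UnitAddCircle}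
    (hμ : IsLimitMeasure S α μ) (hν : IsLimitMeasure S α ν) : μ = ν := by
  have := hμ.isProbabilityMeasure
  have := hν.isProbabilityMeasure
  exact measure_eq_of_integral_continuousMap_eq fun φ =>
    tendsto_nhds_unique (hμ.tendsto_integral φ) (hν.tendsto_integral φ)

theorem IsLimitMeasure.tendsto_expAverage {S : Set ℕ} {α : ℝ} {μ : Measure UnitAddCircle}
    (hμ : IsLimitMeasure S α μ) (k : ℤ) :
    Tendsto (fun N => expAverage S N (k • (α : UnitAddCircle))) atTop
      (𝓝 (∫ x, fourier k x ∂μ)) := by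
  simpa only [integral_fourier_transformMeasure] using hμ.tendsto_integral (fourier k)

theorem zsmul_coe_eq_zero_of_irrational {α : ℝ} (hα : Irrational α) (i : ℤ)
    (h : i • (α : UnitAddCircle) = 0) : i = 0 := by
  by_contra hi
  rw [← AddCircle.coe_zsmul, AddCircle.coe_eq_zero_iff] at h
  obtain ⟨n, hn⟩ := h
  refine (hα.intCast_mul hi).ne_int n ?_
  simpa using hn.symm

theorem Continuous.integrable_unitAddCircle {E : Type*} [NormedAddCommGroup E]
    {f : UnitAddCircle → E} (hf : Continuous f) (μ : Measure UnitAddCircle) [IsFiniteMeasure μ] :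
    Integrable f μ :=
  hf.integrable_of_hasCompactSupport (HasCompactSupport.of_compactSpace _)

/-! ### Atoms along an orbit and the twisted Wiener lemma. -/

/-- The absolutely convergent Fourier series whose coefficients are the masses of `μ` along the
orbit of `x` under the rotation by `a`. -/
noncomputable def atomSeries (μ : Measure UnitAddCircle) (a x : UnitAddCircle) :
    C(UnitAddCircle, ℂ) :=
  ∑' i : ℤ, (μ.real {x + i • a} : ℂ) • fourier i

/-- The orbit points are distinct because `a` has infinite order, so their masses sum to at most the
total mass. -/
theorem summable_measureReal_orbit (μ : Measure UnitAddCircle) [IsFiniteMeasure μ]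
    {a : UnitAddCircle} (ha : ∀ i : ℤ, i • a = 0 → i = 0) (x : UnitAddCircle) :
    Summable fun i : ℤ => μ.real {x + i • a} := by
  refine ENNReal.summable_toReal ?_
  rw [← measure_iUnion (fun i j hij => ?_) fun i => measurableSet_singleton _]
  · exact measure_ne_top _ _
  simp only [Function.onFun, Set.disjoint_singleton]
  intro h
  refine hij (sub_eq_zero.1 (ha _ ?_))
  rw [sub_smul, sub_eq_zero]
  exact add_left_cancel h

theorem summable_atomSeries (μ : Measure UnitAddCircle) [IsFiniteMeasure μ]
    {a : UnitAddCircle} (ha : ∀ i : ℤ, i • a = 0 → i = 0) (x : UnitAddCircle) :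
    Summable fun i : ℤ => (μ.real {x + i • a} : ℂ) • @fourier (1 : ℝ) i := by
  refine (summable_measureReal_orbit μ ha x).of_norm_bounded fun i => ?_
  rw [norm_smul, fourier_norm, mul_one, Complex.norm_real, Real.norm_of_nonneg measureReal_nonneg]

theorem atomSeries_apply (μ : Measure UnitAddCircle) [IsFiniteMeasure μ]
    {a : UnitAddCircle} (ha : ∀ i : ℤ, i • a = 0 → i = 0) (x θ : UnitAddCircle) :
    atomSeries μ a x θ = ∑' i : ℤ, (μ.real {x + i • a} : ℂ) * fourier i θ :=
  (ContinuousMap.tsum_apply (summable_atomSeries μ ha x) θ).symm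

/-- At `0` every character equals `1`, so the series is a sum of nonnegative masses whose term `i =
0` is the mass of `x`. -/
theorem le_re_atomSeries_zero (μ : Measure UnitAddCircle) [IsFiniteMeasure μ]
    {a : UnitAddCircle} (ha : ∀ i : ℤ, i • a = 0 → i = 0) (x : UnitAddCircle) :
    μ.real {x} ≤ (atomSeries μ a x 0).re := by
  have h : atomSeries μ a x 0 = ((∑' i : ℤ, μ.real {x + i • a} : ℝ) : ℂ) := by
    rw [atomSeries_apply μ ha, Complex.ofReal_tsum]
    simp
  rw [h, Complex.ofReal_re]
  simpa using (summable_measureReal_orbit μ ha x).le_tsum 0 fun i _ => measureReal_nonneg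

open AddCircle in
theorem integral_fourier_mul_atomSeries (μ : Measure UnitAddCircle) [IsFiniteMeasure μ]
    {a : UnitAddCircle} (ha : ∀ i : ℤ, i • a = 0 → i = 0) (x : UnitAddCircle) (j : ℤ) :
    ∫ θ, fourier j θ * atomSeries μ a x θ ∂haarAddCircle = μ.real {x - j • a} := by
  have hF : ∀ (i : ℤ) (θ : UnitAddCircle),
      fourier j θ * ((μ.real {x + i • a} : ℂ) * fourier i θ) =
        (μ.real {x + i • a} : ℂ) * fourier (j + i) θ := fun i θ => by
    rw [fourier_add]; ring
  have hsum : ∀ θ : UnitAddCircle, fourier j θ * atomSeries μ a x θ =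
      ∑' i : ℤ, (μ.real {x + i • a} : ℂ) * fourier (j + i) θ := fun θ => by
    rw [atomSeries_apply μ ha, ← tsum_mul_left]
    exact tsum_congr fun i => hF i θ
  simp only [hsum]
  rw [← integral_tsum_of_summable_integral_norm]
  · simp only [integral_const_mul, integral_fourier]
    rw [tsum_eq_single (-j)]
    · simp [sub_eq_add_neg]
    · intro i hi
      rw [if_neg fun h => hi (eq_neg_of_add_eq_zero_right h), mul_zero]
  · exact fun i => ((fourier (j + i)).continuous.integrable_unitAddCircle _).const_mul _
  · refine (summable_measureReal_orbit μ ha x).congr fun i => ?_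
    simp only [norm_mul, norm_fourier_apply, mul_one, Complex.norm_real,
      Real.norm_of_nonneg measureReal_nonneg]
    simp

-- By density it suffices to test characters. For `φ = fourier j` the twist shifts the Wiener
-- average, which then detects the atom at `x - j • a`, exactly the coefficient that `atomSeries`
-- was built to have.
open AddCircle in
theorem tendsto_weightedAverage_integral_fourier (μ : Measure UnitAddCircle)
    [IsProbabilityMeasure μ] {a : UnitAddCircle} (ha : ∀ i : ℤ, i • a = 0 → i = 0)
    (x : UnitAddCircle) (φ : C(UnitAddCircle, ℂ)) :
    Tendsto (fun K => weightedAverage (fun k => fourier (-(k : ℤ)) x * ∫ y, fourier (k : ℤ) y ∂μ)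
      (fun k => (k : ℤ) • a) K φ) atTop
      (𝓝 (∫ θ, φ θ * atomSeries μ a x θ ∂haarAddCircle)) := by
  classical
  refine tendsto_of_tendsto_fourier (L := integralAgainst haarAddCircle (atomSeries μ a x))
    (norm_weightedAverage_le (fun k => ?_) _) (norm_integralAgainst_le _ _) (fun j => ?_) φ
  · rw [norm_mul, norm_fourier_apply, one_mul]
    simpa using norm_integral_le_of_norm_le_const (μ := μ)
      (Eventually.of_forall fun y => (norm_fourier_apply (k : ℤ) y).le)
  · rw [integralAgainst_apply, integral_fourier_mul_atomSeries μ ha]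
    -- With sum and integral exchanged, the average is the integral of a bounded kernel tending to
    -- the indicator of `y = x - j • a`.
    have hlim := tendsto_integral_of_dominated_convergence (μ := μ)
      (F := fun K y => (K : ℂ)⁻¹ * ∑ k ∈ Finset.range K, fourier (k : ℤ) (-x + y + j • a))
      (f := fun y => if -x + y + j • a = 0 then 1 else 0) (fun _ => 1)
      (fun K => (by fun_prop : Continuous _).aestronglyMeasurable) (integrable_const _)
      (fun K => Eventually.of_forall fun y => ?_)
      (Eventually.of_forall fun y => tendsto_average_fourier _)
    · have h1 : (fun y : UnitAddCircle => if -x + y + j • a = 0 then (1 : ℂ) else 0) =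
          Set.indicator {x - j • a} (fun _ => 1) := by
        funext y
        have : -x + y + j • a = 0 ↔ y = x - j • a := by
          constructor
          · intro h; rw [eq_sub_iff_add_eq, ← sub_eq_zero, ← h]; abel
          · rintro rfl; abel
        simp [Set.indicator_apply, this]
      rw [h1, integral_indicator_const _ (measurableSet_singleton _)] at hlim
      simp only [Complex.real_smul, mul_one] at hlim
      refine hlim.congr fun K => ?_
      rw [integral_const_mul, integral_finsetSum _ fun k _ => ?_, weightedAverage_apply]
      · congr 1
        refine Finset.sum_congr rfl fun k _ => ?_
        simp only [fourier_add_apply, fourier_neg_apply, integral_mul_const, integral_const_mul]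
        rw [fourier_zsmul]
      · exact Continuous.integrable_unitAddCircle (by fun_prop) μ
    · have := norm_weightedAverage_le_of_forall (g := fun k => fourier (k : ℤ) (-x + y + j • a))
        (p := fun _ => 0) (C := 1) 1 zero_le_one (fun k => by
        rw [norm_mul, norm_fourier_apply]; simp) K
      simpa [weightedAverage_apply] using this

open AddCircle in
/-- Equidistribution of an orbit of infinite order. -/
theorem tendsto_average_orbit {a : UnitAddCircle} (ha : ∀ i : ℤ, i • a = 0 → i = 0)
    (ψ : C(UnitAddCircle, ℝ)) :
    Tendsto (fun K : ℕ => (K : ℝ)⁻¹ * ∑ k ∈ Finset.range K, ψ ((k : ℤ) • a)) atTop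
      (𝓝 (∫ θ, ψ θ ∂haarAddCircle)) := by
  classical
  let ψ' : C(UnitAddCircle, ℂ) := ⟨fun θ => ψ θ, by fun_prop⟩
  have := tendsto_of_tendsto_fourier (l := atTop)
    (L := integralAgainst haarAddCircle 1) (norm_weightedAverage_le (g := 1) (fun k => by simp) (fun k => (k : ℤ) • a))
    (norm_integralAgainst_le _ _) (fun j => ?_) ψ'
  · have h := (Complex.continuous_re.tendsto _).comp this
    simp only [integralAgainst_apply, ContinuousMap.one_apply, mul_one, ψ',
      ContinuousMap.coe_mk, integral_complex_ofReal, Complex.ofReal_re] at h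
    refine h.congr fun K => ?_
    simp only [Function.comp, weightedAverage_apply, Pi.one_apply, one_mul, ContinuousMap.coe_mk]
    rw [← Complex.ofReal_sum, ← Complex.ofReal_natCast, ← Complex.ofReal_inv, ← Complex.ofReal_mul,
      Complex.ofReal_re]
  · simp only [integralAgainst_apply, ContinuousMap.one_apply, mul_one, weightedAverage_apply,
      Pi.one_apply, one_mul, integral_fourier, fourier_zsmul j]
    have h := tendsto_average_fourier (j • a)
    have h2 : j • a = 0 ↔ j = 0 := ⟨ha j, fun h => by simp [h]⟩
    simpa only [h2] using h

/-! ### Absence of atoms at irrational points. -/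

open AddCircle in
/-- The limit measure of a good set at an irrational point has no atoms. -/
theorem IsGoodSet.measure_singleton_eq_zero {S : Set ℕ} (hS : IsGoodSet S) {α : ℝ}
    (hα : Irrational α) {μ : Measure UnitAddCircle} (hμ : IsLimitMeasure S α μ)
    (x : UnitAddCircle) : μ {x} = 0 := by
  have := hμ.isProbabilityMeasure
  have ha := zsmul_coe_eq_zero_of_irrational hα
  set a : UnitAddCircle := (α : UnitAddCircle)
  by_contra hx
  obtain ⟨m, hm⟩ : ∃ m, m = μ.real {x} := ⟨_, rfl⟩
  have hm0 : 0 < m := hm ▸ ENNReal.toReal_pos hx (measure_ne_top _ _)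
  set A := atomSeries μ a x
  -- Pointwise convergence makes these closed sets cover the circle, so by Baire their interiors
  -- have dense union. The tolerance `m / 16` only has to keep the final constant below `m / 2`.
  let E : ℕ → Set UnitAddCircle := fun n =>
    ⋂ M, ⋂ (_ : n ≤ M), ⋂ N, ⋂ (_ : n ≤ N), {β | ‖expAverage S M β - expAverage S N β‖ ≤ m / 16}
  have hE : ∀ n, IsClosed (E n) := fun n =>
    isClosed_iInter fun M => isClosed_iInter fun _ => isClosed_iInter fun N =>
      isClosed_iInter fun _ => isClosed_le (by fun_prop) (by fun_prop)
  have hEU : ⋃ n, E n = Set.univ := by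
    refine Set.eq_univ_of_forall fun β => ?_
    obtain ⟨l, hl⟩ := hS.exists_tendsto_expAverage β
    obtain ⟨n, hn⟩ := Metric.cauchySeq_iff.1 hl.cauchySeq (m / 16) (by positivity)
    simp only [Set.mem_iUnion, E, Set.mem_iInter, Set.mem_ofPred_eq]
    exact ⟨n, fun M hM N hN => by simpa [dist_eq_norm] using (hn M hM N hN).le⟩
  have hU : IsOpen {θ | m / 2 < (A θ).re} := isOpen_lt (by fun_prop) (by fun_prop)
  obtain ⟨p, hpU, hp⟩ := (dense_iUnion_interior_of_closed hE hEU).inter_open_nonempty _ hU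
    ⟨0, by have := le_re_atomSeries_zero μ ha x; simp only [Set.mem_ofPred_eq, A]; linarith⟩
  obtain ⟨n, hpn⟩ := Set.mem_iUnion.1 hp
  obtain ⟨φ, hφ0, hφ1, hφ⟩ := exists_continuous_zero_one_of_isClosed
    (hU.inter isOpen_interior).isClosed_compl (isClosed_singleton (x := p))
    (Set.disjoint_singleton_right.2 fun h => h ⟨hpU, hpn⟩)
  have hφpos : 0 < ∫ θ, φ θ ∂haarAddCircle :=
    φ.continuous.integral_pos_of_hasCompactSupport_nonneg_nonzero
      (HasCompactSupport.of_compactSpace _) (fun θ => (hφ θ).1) (x := p) (by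
        rw [hφ1 (Set.mem_singleton p)]; exact one_ne_zero)
  have hsupp : ∀ θ, φ θ ≠ 0 → m / 2 < (A θ).re ∧ θ ∈ E n := fun θ hθ => by
    by_contra h
    exact hθ (hφ0 fun h' => h ⟨h'.1, interior_subset h'.2⟩)
  let φ' : C(UnitAddCircle, ℂ) := ⟨fun θ => φ θ, by fun_prop⟩
  have hlower : m / 2 * ∫ θ, φ θ ∂haarAddCircle ≤ ‖∫ θ, φ' θ * A θ ∂haarAddCircle‖ := by
    refine le_trans ?_ (Complex.re_le_norm _)
    have hre : ∫ θ, (φ' θ * A θ).re ∂haarAddCircle = (∫ θ, φ' θ * A θ ∂haarAddCircle).re :=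
      integral_re (𝕜 := ℂ) (f := fun θ => φ' θ * A θ)
        (Continuous.integrable_unitAddCircle (by fun_prop) _)
    rw [← hre, ← integral_const_mul]
    refine integral_mono (Continuous.integrable_unitAddCircle (by fun_prop) _)
      (Continuous.integrable_unitAddCircle (by fun_prop) _) fun θ => ?_
    simp only [φ', ContinuousMap.coe_mk, Complex.re_ofReal_mul]
    rcases eq_or_ne (φ θ) 0 with h | h
    · simp [h]
    · rw [mul_comm]
      exact mul_le_mul_of_nonneg_left (hsupp θ h).1.le (hφ θ).1
  have hupper : ∀ M, n ≤ M → ‖∫ θ, φ' θ * A θ ∂haarAddCircle‖ ≤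
      m / 8 * ∫ θ, φ θ ∂haarAddCircle + 16 / m * ((initialSegment S M).card : ℝ)⁻¹ := by
    intro M hM
    let ψ : C(UnitAddCircle, ℝ) := ⟨fun θ => φ θ * (‖expAverage S M θ‖ + m / 16), by fun_prop⟩
    have h1 : ‖∫ θ, φ' θ * A θ ∂haarAddCircle‖ ≤ ∫ θ, ψ θ ∂haarAddCircle := by
      -- The comparison is termwise in `k`: where `φ` is nonzero, `k • a` lies in `E n`, so letting
      -- `N → ∞` puts `μ̂(k)` within `m / 16` of the `M`th average there.
      refine le_of_tendsto_of_tendsto'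
        (tendsto_weightedAverage_integral_fourier μ ha x φ').norm (tendsto_average_orbit ha ψ)
        fun K => ?_
      rw [weightedAverage_apply, norm_mul, norm_inv, Complex.norm_natCast]
      refine mul_le_mul_of_nonneg_left (norm_sum_le_of_le _ fun k _ => ?_) (by positivity)
      simp only [φ', ψ, ContinuousMap.coe_mk, norm_mul, norm_fourier_apply, one_mul,
        Complex.norm_real, Real.norm_of_nonneg (hφ _).1]
      rw [mul_comm]
      rcases eq_or_ne (φ ((k : ℤ) • a)) 0 with h | h
      · rw [h, zero_mul, zero_mul]
      refine mul_le_mul_of_nonneg_left ?_ (hφ _).1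
      refine le_of_tendsto (hμ.tendsto_expAverage k).norm ?_
      filter_upwards [eventually_ge_atTop n] with N hN
      have hk := (hsupp _ h).2
      simp only [E, Set.mem_iInter, Set.mem_ofPred_eq] at hk
      linarith [hk N hN M hM, norm_le_norm_add_norm_sub' (expAverage S N ((k : ℤ) • a))
        (expAverage S M ((k : ℤ) • a))]
    refine h1.trans ?_
    rw [← integral_norm_sq_expAverage, ← integral_const_mul, ← integral_const_mul,
      ← integral_add (Continuous.integrable_unitAddCircle (by fun_prop) _)
        (Continuous.integrable_unitAddCircle (by fun_prop) _)]
    refine integral_mono (Continuous.integrable_unitAddCircle (by fun_prop) _)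
      (Continuous.integrable_unitAddCircle (by fun_prop) _) fun θ => ?_
    simp only [ψ, ContinuousMap.coe_mk]
    obtain ⟨h0, h1⟩ := hφ θ
    -- This trades the first power for the square, whose integral is known, at the cost of another
    -- `m / 16`.
    have ht : ‖expAverage S M θ‖ ≤ m / 16 + 16 / m * ‖expAverage S M θ‖ ^ 2 := by
      have hid : m / 16 + 16 / m * ‖expAverage S M θ‖ ^ 2 - ‖expAverage S M θ‖ =
          16 / m * ((‖expAverage S M θ‖ - m / 32) ^ 2 + 3 * m ^ 2 / 1024) := by
        field_simp; ring
      have : 0 ≤ 16 / m * ((‖expAverage S M θ‖ - m / 32) ^ 2 + 3 * m ^ 2 / 1024) := by positivity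
      linarith
    have hq : 0 ≤ 16 / m * ‖expAverage S M θ‖ ^ 2 := by positivity
    -- The bound `φ ≤ 1` removes the weight from the quadratic term.
    nlinarith [mul_le_mul_of_nonneg_left ht h0, mul_le_mul_of_nonneg_right h1 hq]
  have hlim : Tendsto (fun M => m / 8 * ∫ θ, φ θ ∂haarAddCircle +
      16 / m * ((initialSegment S M).card : ℝ)⁻¹) atTop (𝓝 (m / 8 * ∫ θ, φ θ ∂haarAddCircle)) := by
    simpa using ((tendsto_inv_atTop_nhds_zero_nat (𝕜 := ℝ)).comp
      (tendsto_card_initialSegment hS)).const_mul (16 / m) |>.const_add _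
  -- Letting `M → ∞` leaves `m / 2 * ∫ φ ≤ m / 8 * ∫ φ`, impossible since `∫ φ > 0`.
  have hle := ge_of_tendsto hlim ((eventually_ge_atTop n).mono hupper)
  nlinarith [mul_pos hm0 hφpos]

theorem mainTheorem1 (α : ℝ) (hα : Irrational α) :
    (∀ S : Set ℕ, IsGoodSet S →
      ∃ μ : Measure UnitAddCircle,
        IsLimitMeasure S α μ ∧ (∀ μ' : Measure UnitAddCircle, IsLimitMeasure S α μ' → μ' = μ) ∧
          ∀ x : UnitAddCircle, μ {x} = 0) ∧
    (∀ ν : Measure UnitAddCircle, IsFiniteMeasure ν → IsRepresentable ν α →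
      ∀ x : UnitAddCircle, ν {x} = 0) := by
  refine ⟨fun S hS => ?_, fun ν _ ⟨S, hS, hν⟩ x => ?_⟩
  · obtain ⟨μ, hμ⟩ := hS.exists_isLimitMeasure α
    exact ⟨μ, hμ, fun μ' hμ' => hμ'.unique hμ, hS.measure_singleton_eq_zero hα hμ⟩
  · have h := hS.measure_singleton_eq_zero hα hν x
    rw [Measure.smul_apply, smul_eq_mul, mul_eq_zero, ENNReal.inv_eq_zero] at h
    -- The normalizing factor could vanish only if `ν` had infinite mass.
    exact h.resolve_left (measure_ne_top _ _)
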